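/- **Conventions.** All manifolds are smooth, Hausdorff and four-dimensional. A *continuous spacetime* $(M_{\rm ext},g_{\rm ext})$ is such a manifold with a continuous metric $g_{\rm ext}$ of signature $(-,+,+,+)$ and a time orientation given by a continuous timelike vector field $\tau$; a vector $v$ with $g_{\rm ext}(v,v)\le 0$ (resp. $<0$) and $g_{\rm ext}(\tau,v)<0$ is *future directed causal* (resp. *timelike*). A continuous extension of a $C^2$ spacetime $(M,g)$ is a continuous spacetime $(M_{\rm ext},g_{\rm ext})$ containing $M$ as a proper open subset on which $g=g_{\rm ext}|_M$ is $C^2$ in all coordinates, with the induced time orientation. Vector fields on $M$ are of class $C^1$. A future directed *causal curve* is a locally Lipschitz curve $[a,b]\to M_{\rm ext}$ whose velocity is future directed causal almost everywhere; for a Lorentzian metric $h$ and a time orientation on an open set $U$, a future directed *$h$-timelike curve* is a locally Lipschitz curve $c$ in $U$ whose velocity is future directed almost everywhere with $h(c',c')<-\delta$ almost everywhere for some $\delta>0$, and $I^+_h(p,U)$ is the set of endpoints of such curves $[a,b]\to U$, $a<b$, that start at $p$. $(M_{\rm ext},g_{\rm ext})$ is *strongly causal at* $p$ if every neighbourhood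 $U$ of $p$ contains a neighbourhood $V$ of $p$ such that every causal curve with both endpoints in $V$ lies in $U$. A function $f$ on $M$ *extends continuously to* $\mathcal O\notin M$ with value $c$ if setting $f(\mathcal O)=c$ makes it continuous on $M\cup\{\mathcal O\}$; a tensor on $M$ extends continuously to $\mathcal O$ if its components in some coordinate neighbourhood $U$ of $\mathcal O$ extend continuously to $(U\cap M)\cup\{\mathcal O\}$, and the values of the components at $\mathcal O$ define its continuous extension at $\mathcal O$. **Theorem.** Let $(M_{\rm ext},g_{\rm ext})$ be a continuous extension of a $C^2$ spacetime $(M,g)$, let $u$ be a unit future directed timelike vector field on $M$ (so $g(u,u)=-1$), let $\mathcal O\in M_{\rm ext}\setminus M$ and $\rho_0,p_0\in\mathbb R$. Let $T=\frac1{8\pi}\big(\mathrm{Ric}-\frac12Rg\big)$ on $M$. Assume: (a) $\mathcal O$ is an origin point for $u$: each maximal integral curve of $u$ in $M$ can be parameterized as $\gamma:(0,b)\to M$, $0<b\le\infty$, with $\gamma(t)\to\mathcal O$ as $t\to0$, and the extension $\tilde\gamma$ by $\tilde\gamma(0)=\mathcal O$ has a one-sided derivative $\tilde\gamma'(0)=\lim_{t\to0}\gamma'(t)$.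 (b) $T$ limits to a perfect fluid $(u,\rho_0,p_0)$ at $\mathcal O$: the function $T(u,u)$ extends continuously to $\mathcal O$ with value $\rho_0$; for every unit spacelike vector field $e$ on $M$ orthogonal to $u$, the function $T(e,e)$ extends continuously to $\mathcal O$ with value $p_0$; and the tensor $T-\big[(\rho_0+p_0)\,u_*\otimes u_*+p_0g\big]$, where $u_*=g(u,\cdot)$, extends continuously to $\mathcal O$ with value $0$. (c) For some integral curve $\gamma$ of $u$, parameterized as in (a), $M$ is locally timelike convex about $\gamma$ near $\mathcal O$: there are $0<\varepsilon<2$ and a coordinate neighbourhood $U\subset M_{\rm ext}$ centered at $\mathcal O$, with coordinates $(x^0,\dots,x^3)$, such that the components $g_{\mu\nu}$ of $g_{\rm ext}$ satisfy $g_{\mu\nu}(\mathcal O)=\eta_{\mu\nu}=\mathrm{diag}(-1,1,1,1)_{\mu\nu}$ and $|g_{\mu\nu}(p)-\eta_{\mu\nu}|<\varepsilon$ for all $p\in U$; $\partial_0|_{\mathcal O}=\tilde\gamma'(0)$; and $I^+_{\eta_\varepsilon}(\mathcal O,U)\subset M$, where $\eta_\varepsilon=-\frac{\varepsilon}{2-\varepsilon}(dx^0)^2+\delta_{ij}dx^idx^j$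 is time oriented by $\partial_0$. (d) The Ricci tensor $\mathrm{Ric}$ of $(M,g)$ extends continuously to $\mathcal O$, with continuous extension $\widetilde{\mathrm{Ric}}|_{\mathcal O}$ there. (e) $(M_{\rm ext},g_{\rm ext})$ is strongly causal at $\mathcal O$. Then $\rho_0=-p_0$, and $\widetilde{\mathrm{Ric}}|_{\mathcal O}=8\pi\rho_0\,g_{\rm ext}|_{\mathcal O}$. -/

import Mathlib

open scoped Manifold ContDiff Topology

noncomputable section

namespace Cosmology

/-- The model space `ℝ⁴`. -/
abbrev R4 : Type := EuclideanSpace ℝ (Fin 4)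

/-- The Minkowski components `η_{μν} = diag(-1, 1, 1, 1)`. -/
def eta (μ ν : Fin 4) : ℝ := if μ = ν then (if μ = 0 then -1 else 1) else 0

/-- The coefficients `diag(-ε / (2 - ε), 1, 1, 1)` of the narrow Minkowskian metric `η_ε`. -/
def narrowEta (ε : ℝ) (μ ν : Fin 4) : ℝ :=
  if μ = ν then (if μ = 0 then -(ε / (2 - ε)) else 1) else 0

section Manifold

variable {X : Type*} [TopologicalSpace X] [ChartedSpace R4 X]

/-- Not necessarily continuous covariant 2-tensor fields on the four-manifold `X`. -/
abbrev Tensor2 (X : Type*) [TopologicalSpace X] [ChartedSpace R4 X] : Type _ :=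
  ∀ p : X, LinearMap.BilinForm ℝ (TangentSpace (𝓡 4) p)

/-- Not necessarily continuous vector fields on the four-manifold `X`. -/
abbrev VField (X : Type*) [TopologicalSpace X] [ChartedSpace R4 X] : Type _ :=
  ∀ p : X, TangentSpace (𝓡 4) p

/-- `e` is a smooth coordinate chart of `X` (with coordinate neighbourhood `e.source`). -/
def IsCoord (e : OpenPartialHomeomorph X R4) : Prop :=
  e ∈ IsManifold.maximalAtlas (𝓡 4) ∞ X

/-- The coordinate vector `∂_μ|_p` of the chart `e` (meaningful for `p ∈ e.source`). -/
def coordVec (e : OpenPartialHomeomorph X R4) (μ : Fin 4) (p : X) : TangentSpace (𝓡 4) p :=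
  (mfderiv (𝓡 4) (𝓡 4) e.symm (e p) : R4 →L[ℝ] R4) (EuclideanSpace.single μ 1)

/-- The coordinate differentials `(dx⁰, …, dx³)` at `p` of the chart `e`. -/
def coordDiff (e : OpenPartialHomeomorph X R4) (p : X) : TangentSpace (𝓡 4) p →L[ℝ] R4 :=
  mfderiv (𝓡 4) (𝓡 4) e p

/-- The components `S_{μν} = S(∂_μ, ∂_ν)` of a 2-tensor in the chart `e`. -/
def comp (S : Tensor2 X) (e : OpenPartialHomeomorph X R4) (μ ν : Fin 4) (p : X) : ℝ :=
  S p (coordVec e μ p) (coordVec e ν p)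

/-- The tensor with components `A_{μν}` at `p` in the chart `e`, that is
`A_{μν} dx^μ ⊗ dx^ν`. -/
def ofComp (e : OpenPartialHomeomorph X R4) (p : X) (A : Matrix (Fin 4) (Fin 4) ℝ) :
    LinearMap.BilinForm ℝ (TangentSpace (𝓡 4) p) :=
  (Matrix.toBilin (EuclideanSpace.basisFun (Fin 4) ℝ).toBasis A).comp
    (coordDiff e p).toLinearMap (coordDiff e p).toLinearMap

/-! ### Curvature -/

/-- The coordinate partial derivative `∂_μ f`. -/
def pd (μ : Fin 4) (f : R4 → ℝ) (y : R4) : ℝ := fderiv ℝ f y (EuclideanSpace.single μ 1)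

/-- Christoffel symbols `Γ^k_{ij} = ½ g^{kl} (∂_i g_{jl} + ∂_j g_{il} - ∂_l g_{ij})`
of a matrix-valued function `G = (g_{ij})` on `ℝ⁴`. -/
def christoffel (G : R4 → Matrix (Fin 4) (Fin 4) ℝ) (k i j : Fin 4) (y : R4) : ℝ :=
  (1 / 2) * ∑ l, (G y)⁻¹ k l *
    (pd i (fun z => G z j l) y + pd j (fun z => G z i l) y - pd l (fun z => G z i j) y)

/-- Coordinate components of the Ricci tensor,
`R_{ij} = ∂_k Γ^k_{ij} - ∂_j Γ^k_{ik} + Γ^k_{kl} Γ^l_{ij} - Γ^k_{jl} Γ^l_{ik}`. -/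
def ricciCoord (G : R4 → Matrix (Fin 4) (Fin 4) ℝ) (y : R4) : Matrix (Fin 4) (Fin 4) ℝ :=
  Matrix.of fun i j =>
    (∑ k, pd k (christoffel G k i j) y) - (∑ k, pd j (christoffel G k i k) y)
    + (∑ k, ∑ l, christoffel G k k l y * christoffel G l i j y)
    - (∑ k, ∑ l, christoffel G k j l y * christoffel G l i k y)

/-- The metric components in the chart `e`, as a matrix-valued function of the coordinates. -/
def coordMatrix (g : Tensor2 X) (e : OpenPartialHomeomorph X R4) (y : R4) :
    Matrix (Fin 4) (Fin 4) ℝ :=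
  Matrix.of fun μ ν => comp g e μ ν (e.symm y)

/-- The Ricci tensor of `g`; at each point `p` it is computed in the preferred chart at `p`
(where `g` is `C²` near `p` and nondegenerate, the result does not depend on the chart). -/
def Ric (g : Tensor2 X) : Tensor2 X := fun p =>
  ofComp (chartAt R4 p) p (ricciCoord (coordMatrix g (chartAt R4 p)) (chartAt R4 p p))

/-- The `g`-trace `g^{μν} S_{μν}` of a 2-tensor `S`, computed in the preferred chart. -/
def trg (g S : Tensor2 X) (p : X) : ℝ :=
  ∑ μ, ∑ ν, (coordMatrix g (chartAt R4 p) (chartAt R4 p p))⁻¹ μ ν * comp S (chartAt R4 p) μ ν p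

/-- The energy-momentum tensor `T = (1 / 8π) (Ric - ½ R g)`. -/
def energyMomentum (g : Tensor2 X) : Tensor2 X := fun p =>
  (1 / (8 * Real.pi)) • (Ric g p - ((1 / 2) * trg g (Ric g) p) • g p)

/-- The perfect fluid tensor `(ρ₀ + p₀) u_* ⊗ u_* + p₀ g` with `u_* = g(u, ·)`. -/
def perfectFluid (g : Tensor2 X) (u : VField X) (ρ₀ p₀ : ℝ) : Tensor2 X := fun p =>
  (ρ₀ + p₀) • LinearMap.BilinForm.linMulLin (g p (u p)) (g p (u p)) + p₀ • g p

/-! ### Spacetimes -/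

/-- A continuous (`C⁰`) spacetime structure on `X`: a continuous Lorentzian metric, with a time
orientation given by a continuous timelike vector field. -/
structure Spacetime (X : Type*) [TopologicalSpace X] [ChartedSpace R4 X]
    [IsManifold (𝓡 4) ∞ X] where
  /-- the metric -/
  g : Tensor2 X
  /-- the vector field that defines the time orientation -/
  timeField : VField X
  symm : ∀ p v w, g p v w = g p w v
  lorentzian : ∀ p, ∃ b : Module.Basis (Fin 4) ℝ (TangentSpace (𝓡 4) p),
    ∀ μ ν, g p (b μ) (b ν) = eta μ ν
  continuous_metric : ∀ e : OpenPartialHomeomorph X R4, IsCoord e →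
    ∀ μ ν, ContinuousOn (comp g e μ ν) e.source
  timelike_timeField : ∀ p, g p (timeField p) (timeField p) < 0
  continuous_timeField :
    Continuous fun p => (⟨p, timeField p⟩ : TangentBundle (𝓡 4) X)

/-- The components of the tensor `g` are `C²` on the open set `M`, in all coordinates. -/
def IsC2On (g : Tensor2 X) (M : Set X) : Prop :=
  ∀ e : OpenPartialHomeomorph X R4, IsCoord e → ∀ μ ν,
    ContDiffOn ℝ 2 (fun y => comp g e μ ν (e.symm y)) (e.target ∩ e.symm ⁻¹' M)

/-- `w` is a `C¹` vector field on the open set `M` (its values off `M` are irrelevant). -/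
def IsC1FieldOn [IsManifold (𝓡 4) ∞ X] (w : VField X) (M : Set X) : Prop :=
  ContMDiffOn (𝓡 4) (𝓡 4).tangent 1 (fun p => (⟨p, w p⟩ : TangentBundle (𝓡 4) X)) M

/-- `v` is a future directed timelike vector, for the metric `g` and the time orientation `τ`. -/
def FutureTimelike (g : Tensor2 X) (τ : VField X) (p : X) (v : TangentSpace (𝓡 4) p) : Prop :=
  g p v v < 0 ∧ g p (τ p) v < 0

/-- `u` is a unit future directed timelike `C¹` vector field on `M`. -/
def IsObserverField [IsManifold (𝓡 4) ∞ X] (S : Spacetime X) (M : Set X) (u : VField X) :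
    Prop :=
  IsC1FieldOn u M ∧
    ∀ p ∈ M, FutureTimelike S.g S.timeField p (u p) ∧ S.g p (u p) (u p) = -1

/-! ### Curves and causality -/

/-- At parameter `t` the curve `γ` passes through `p`, with velocity `v` (derivative taken
within the parameter set `s`). -/
def HasVelocityWithin (γ : ℝ → X) (s : Set ℝ) (t : ℝ) (p : X) (v : TangentSpace (𝓡 4) p) :
    Prop :=
  γ t = p ∧
    HasMFDerivWithinAt 𝓘(ℝ, ℝ) (𝓡 4) γ s t ((1 : ℝ →L[ℝ] ℝ).smulRight (v : R4))

/-- `γ` is locally Lipschitz on `[a, b]` (as seen in coordinates). -/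
def LocLipschitz (γ : ℝ → X) (a b : ℝ) : Prop :=
  ContinuousOn γ (Set.Icc a b) ∧ ∀ t ∈ Set.Icc a b, ∃ K : NNReal, ∃ s ∈ 𝓝[Set.Icc a b] t,
    LipschitzOnWith K (fun r => chartAt R4 (γ t) (γ r)) s

/-- `γ : [a, b] → X` is a future directed causal curve: locally Lipschitz, with future directed
causal velocity almost everywhere (`g(τ, v) < 0` forces `v ≠ 0`). -/
def IsCausalCurve (g : Tensor2 X) (τ : VField X) (γ : ℝ → X) (a b : ℝ) : Prop :=
  LocLipschitz γ a b ∧ ∀ᵐ t : ℝ, t ∈ Set.Icc a b → ∃ v : TangentSpace (𝓡 4) (γ t),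
    HasVelocityWithin γ (Set.Icc a b) t (γ t) v ∧
      g (γ t) v v ≤ 0 ∧ g (γ t) (τ (γ t)) v < 0

/-- `γ : [a, b] → X` is a future directed timelike curve: locally Lipschitz, with future directed
velocity satisfying `g(γ', γ') < -δ` almost everywhere, for some `δ > 0`. -/
def IsTimelikeCurve (g : Tensor2 X) (τ : VField X) (γ : ℝ → X) (a b : ℝ) : Prop :=
  LocLipschitz γ a b ∧ ∃ δ > 0, ∀ᵐ t : ℝ, t ∈ Set.Icc a b → ∃ v : TangentSpace (𝓡 4) (γ t),
    HasVelocityWithin γ (Set.Icc a b) t (γ t) v ∧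
      g (γ t) v v < -δ ∧ g (γ t) (τ (γ t)) v < 0

/-- The timelike future `I⁺(p, U)`. -/
def timelikeFuture (g : Tensor2 X) (τ : VField X) (p : X) (U : Set X) : Set X :=
  {q | ∃ (γ : ℝ → X) (a b : ℝ), a < b ∧ IsTimelikeCurve g τ γ a b ∧
    Set.MapsTo γ (Set.Icc a b) U ∧ γ a = p ∧ γ b = q}

/-- Strong causality at `p`: every neighbourhood `U` of `p` contains a neighbourhood `V` of `p`
such that causal curves with both endpoints in `V` stay in `U`. -/
def StronglyCausalAt (g : Tensor2 X) (τ : VField X) (p : X) : Prop :=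
  ∀ U ∈ 𝓝 p, ∃ V ∈ 𝓝 p, V ⊆ U ∧ ∀ (γ : ℝ → X) (a b : ℝ), a < b → IsCausalCurve g τ γ a b →
    γ a ∈ V → γ b ∈ V → Set.MapsTo γ (Set.Icc a b) U

/-! ### Origin points -/

/-- `γ : J → M` is an integral curve of `u` in `M`, with `J` a nonempty open interval. -/
def IsIntegralIn (M : Set X) (u : VField X) (γ : ℝ → X) (J : Set ℝ) : Prop :=
  IsOpen J ∧ J.OrdConnected ∧ J.Nonempty ∧
    ∀ t ∈ J, γ t ∈ M ∧ HasVelocityWithin γ J t (γ t) (u (γ t))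

/-- `γ : J → M` is a maximal (inextendible in `M`) integral curve of `u`. -/
def IsMaxIntegralIn (M : Set X) (u : VField X) (γ : ℝ → X) (J : Set ℝ) : Prop :=
  IsIntegralIn M u γ J ∧
    ∀ (δ : ℝ → X) (J' : Set ℝ), IsIntegralIn M u δ J' → J ⊆ J' → Set.EqOn δ γ J → J' = J

open scoped Classical in
/-- The curve `γ`, extended to the parameter `a` by the value `O`. -/
def extendCurve (γ : ℝ → X) (a : ℝ) (O : X) : ℝ → X := Function.update γ a O

/-- `O` is an origin point for `u`: it lies off `M`, and each (maximal) integral curve `γ` of `u`,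
with parameter interval `(a, b)`, has `a > -∞`, tends to `O` as `t → a`, and its extension by `O`
has a one-sided velocity `v` at `a`, which is the limit of the velocities `γ'(t) = u(γ(t))`. -/
def IsOriginPoint [IsManifold (𝓡 4) ∞ X] (M : Set X) (u : VField X) (O : X) : Prop :=
  O ∉ M ∧ ∀ (γ : ℝ → X) (J : Set ℝ), IsMaxIntegralIn M u γ J →
    ∃ a : ℝ, IsGLB J a ∧ Filter.Tendsto γ (𝓝[>] a) (𝓝 O) ∧
      ∃ v : TangentSpace (𝓡 4) O,
        HasVelocityWithin (extendCurve γ a O) (Set.Ici a) a O v ∧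
        Filter.Tendsto (fun t => (⟨γ t, u (γ t)⟩ : TangentBundle (𝓡 4) X)) (𝓝[>] a)
          (𝓝 (⟨O, v⟩ : TangentBundle (𝓡 4) X))

/-! ### Continuous extensions to `M ∪ {O}` -/

open scoped Classical in
/-- The function `f` on `M` extends continuously to `M ∪ {O}`, with the value `c` at `O ∉ M`. -/
def FunExtends (M : Set X) (O : X) (f : X → ℝ) (c : ℝ) : Prop :=
  ContinuousOn (Function.update f O c) (M ∪ {O})

/-- The tensor `S` on `M` extends continuously to `M ∪ {O}`, and its continuous extension at
`O ∉ M` is `B`: in some coordinate neighbourhood `U` of `O` the components of `S` extend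
continuously to `(U ∩ M) ∪ {O}`, with the components of `B` as values at `O`. -/
def TensorExtends (M : Set X) (O : X) (S : Tensor2 X)
    (B : LinearMap.BilinForm ℝ (TangentSpace (𝓡 4) O)) : Prop :=
  ∃ e : OpenPartialHomeomorph X R4, IsCoord e ∧ O ∈ e.source ∧ ∀ μ ν,
    FunExtends (e.source ∩ M) O (comp S e μ ν) (B (coordVec e μ O) (coordVec e ν O))

/-! ### The hypotheses on the fluid and on the shape of `M` -/

/-- The energy-momentum tensor of `g` on `M` limits to a perfect fluid `(u, ρ₀, p₀)` at `O`. -/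
def LimitsToPerfectFluid [IsManifold (𝓡 4) ∞ X] (g : Tensor2 X) (M : Set X) (u : VField X)
    (O : X) (ρ₀ p₀ : ℝ) : Prop :=
  FunExtends M O (fun p => energyMomentum g p (u p) (u p)) ρ₀ ∧
  (∀ w : VField X, IsC1FieldOn w M →
    (∀ p ∈ M, g p (w p) (w p) = 1 ∧ g p (u p) (w p) = 0) →
    FunExtends M O (fun p => energyMomentum g p (w p) (w p)) p₀) ∧
  TensorExtends M O (fun p => energyMomentum g p - perfectFluid g u ρ₀ p₀ p) 0

/-- The metric `η_ε = -(ε / (2 - ε)) (dx⁰)² + (dx¹)² + (dx²)² + (dx³)²` on the domain of the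
chart `e`. -/
def narrowMetric (ε : ℝ) (e : OpenPartialHomeomorph X R4) : Tensor2 X := fun p =>
  ofComp e p (Matrix.of (narrowEta ε))

/-- `M` is locally timelike convex about `γ` near `O`, where `γ` is an integral curve with
parameter interval `(a, b)` that tends to `O` as `t → a`. The range `0 < ε < 2` is exactly the
one for which `η_ε` is a Lorentzian metric; it is time oriented by `∂₀`. -/
def LocTimelikeConvex (g : Tensor2 X) (M : Set X) (γ : ℝ → X) (a : ℝ) (O : X) : Prop :=
  ∃ ε : ℝ, 0 < ε ∧ ε < 2 ∧ ∃ e : OpenPartialHomeomorph X R4,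
    IsCoord e ∧ O ∈ e.source ∧ e O = 0 ∧
    (∀ μ ν, comp g e μ ν O = eta μ ν ∧ ∀ p ∈ e.source, |comp g e μ ν p - eta μ ν| < ε) ∧
    HasVelocityWithin (extendCurve γ a O) (Set.Ici a) a O (coordVec e 0 O) ∧
    timelikeFuture (narrowMetric ε e) (coordVec e 0) O e.source ⊆ M

end Manifold

end Cosmology

end

noncomputable section

namespace Cosmology

theorem FunExtends.tendsto {X : Type*} [TopologicalSpace X] {M : Set X} {O : X} {f : X → ℝ}
    {c : ℝ} (h : FunExtends M O f c)
    (hO : O ∉ M) : Filter.Tendsto f (𝓝[M] O) (𝓝 c) := by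
  classical
  have h1 := h O (by simp)
  have h2 := (h1.mono (Set.subset_union_left (t := {O}))).tendsto
  rw [Function.update_self] at h2
  refine h2.congr' ?_
  filter_upwards [self_mem_nhdsWithin] with x hx
  exact Function.update_of_ne (by rintro rfl; exact hO hx) _ _

section ChartCalculus

variable {X : Type*} [TopologicalSpace X] [ChartedSpace R4 X]
  {e e' : OpenPartialHomeomorph X R4} {p : X}

theorem tendsto_matrix_iff {ι : Type*} {l : Filter ι} {F : ι → Matrix (Fin 4) (Fin 4) ℝ}
    {A : Matrix (Fin 4) (Fin 4) ℝ} :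
    Filter.Tendsto F l (𝓝 A) ↔ ∀ μ ν, Filter.Tendsto (fun i => F i μ ν) l (𝓝 (A μ ν)) := by
  exact tendsto_pi_nhds.trans (forall_congr' fun μ => tendsto_pi_nhds)

theorem IsCoord.mdifferentiableAt (he : IsCoord e) (hp : p ∈ e.source) :
    MDifferentiableAt (𝓡 4) (𝓡 4) e p :=
  (contMDiffAt_of_mem_maximalAtlas he hp).mdifferentiableAt (by simp)

theorem IsCoord.mdifferentiableAt_symm (he : IsCoord e) {y : R4} (hy : y ∈ e.target) :
    MDifferentiableAt (𝓡 4) (𝓡 4) e.symm y :=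
  ((contMDiffOn_symm_of_mem_maximalAtlas he).contMDiffAt
    (e.open_target.mem_nhds hy)).mdifferentiableAt (by simp)

/-- The differential of the inverse of a chart, at the image of `p`. -/
def coordPush (e : OpenPartialHomeomorph X R4) (p : X) : R4 →L[ℝ] TangentSpace (𝓡 4) p :=
  (mfderiv (𝓡 4) (𝓡 4) e.symm (e p) : R4 →L[ℝ] R4)

theorem coordVec_eq_coordPush (μ : Fin 4) :
    coordVec e μ p = coordPush e p (EuclideanSpace.single μ 1) := rfl

theorem IsCoord.coordDiff_coordPush (he : IsCoord e) (hp : p ∈ e.source) (w : R4) :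
    coordDiff e p (coordPush e p w) = w := by
  have h1 : HasMFDerivAt (𝓡 4) (𝓡 4) e (e.symm (e p)) (mfderiv (𝓡 4) (𝓡 4) e (e.symm (e p))) :=
    (he.mdifferentiableAt (by rwa [e.left_inv hp])).hasMFDerivAt
  have h2 := (he.mdifferentiableAt_symm (e.map_source hp)).hasMFDerivAt
  have h3 := h1.comp (e p) h2
  have h4 : HasMFDerivAt (𝓡 4) (𝓡 4) (e ∘ e.symm) (e p)
      (ContinuousLinearMap.id ℝ (TangentSpace (𝓡 4) (e p))) := by
    refine (hasMFDerivAt_id (e p)).congr_of_eventuallyEq ?_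
    filter_upwards [e.open_target.mem_nhds (e.map_source hp)] with y hy
    simp [e.right_inv hy]
  have h5 := hasMFDerivAt_unique h3 h4
  have h6 := congrArg (fun L : R4 →L[ℝ] R4 => L w) h5
  have h7 : e.symm (e p) = p := e.left_inv hp
  have h8 : ∀ q, q = p → (mfderiv (𝓡 4) (𝓡 4) e q : R4 →L[ℝ] R4)
      ((mfderiv (𝓡 4) (𝓡 4) e.symm (e p) : R4 →L[ℝ] R4) w) = w →
      (mfderiv (𝓡 4) (𝓡 4) e p : R4 →L[ℝ] R4)
      ((mfderiv (𝓡 4) (𝓡 4) e.symm (e p) : R4 →L[ℝ] R4) w) = w := by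
    rintro q rfl h; exact h
  exact h8 _ h7 h6

theorem IsCoord.coordPush_coordDiff (he : IsCoord e) (hp : p ∈ e.source)
    (v : TangentSpace (𝓡 4) p) : coordPush e p (coordDiff e p v) = v := by
  have h1 := (he.mdifferentiableAt hp).hasMFDerivAt
  have h2 := (he.mdifferentiableAt_symm (e.map_source hp)).hasMFDerivAt
  have h3 := h2.comp p h1
  have h4 : HasMFDerivAt (𝓡 4) (𝓡 4) (e.symm ∘ e) p
      (ContinuousLinearMap.id ℝ (TangentSpace (𝓡 4) p)) := by
    refine (hasMFDerivAt_id p).congr_of_eventuallyEq ?_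
    filter_upwards [e.open_source.mem_nhds hp] with y hy
    simp [e.left_inv hy]
  have h5 := hasMFDerivAt_unique h3 h4
  exact congrArg (fun L : R4 →L[ℝ] R4 => L v) h5

theorem IsCoord.sum_coordVec (he : IsCoord e) (hp : p ∈ e.source)
    (v : TangentSpace (𝓡 4) p) : v = ∑ μ, (coordDiff e p v) μ • coordVec e μ p := by
  conv_lhs => rw [← he.coordPush_coordDiff hp v]
  have h : coordDiff e p v = ∑ μ, (coordDiff e p v) μ • EuclideanSpace.single μ (1 : ℝ) := by
    ext i
    simp [Finset.sum_apply, Pi.single_apply]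
  conv_lhs => rw [h]
  rw [map_sum]
  simp only [map_smul, coordVec_eq_coordPush]

/-- The matrix of coordinates of the vectors `∂_μ` of `e'` in the chart `e`. -/
def transition (e e' : OpenPartialHomeomorph X R4) (p : X) : Matrix (Fin 4) (Fin 4) ℝ :=
  Matrix.of fun ν μ => (coordDiff e p (coordVec e' μ p)) ν

/-- The components of a 2-tensor as a matrix. -/
def compMatrix (S : Tensor2 X) (e : OpenPartialHomeomorph X R4) (p : X) :
    Matrix (Fin 4) (Fin 4) ℝ := Matrix.of fun μ ν => comp S e μ ν p

theorem IsCoord.compMatrix_change (he : IsCoord e) (hp : p ∈ e.source) (S : Tensor2 X) :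
    compMatrix S e' p = (transition e e' p).transpose * compMatrix S e p * transition e e' p := by
  ext μ ν
  simp only [compMatrix, comp, Matrix.of_apply, Matrix.mul_apply, Matrix.transpose_apply,
    transition]
  conv_lhs => rw [he.sum_coordVec hp (coordVec e' μ p), he.sum_coordVec hp (coordVec e' ν p)]
  simp only [map_sum, map_smul, LinearMap.sum_apply, LinearMap.smul_apply, smul_eq_mul,
    Finset.sum_mul, Finset.mul_sum]
  refine Finset.sum_congr rfl fun i _ => Finset.sum_congr rfl fun j _ => ?_
  ring

theorem IsCoord.transition_mul (he : IsCoord e) (he' : IsCoord e') (hp : p ∈ e.source)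
    (hp' : p ∈ e'.source) : transition e e' p * transition e' e p = 1 := by
  ext μ ν
  simp only [Matrix.mul_apply, transition, Matrix.of_apply]
  have h := he.coordDiff_coordPush hp (EuclideanSpace.single ν 1)
  rw [← coordVec_eq_coordPush, he'.sum_coordVec hp' (coordVec e ν p)] at h
  have h2 := congrArg (fun w : R4 => w μ) h
  simp only [map_sum, map_smul] at h2
  simp only [PiLp.smul_apply, smul_eq_mul, WithLp.ofLp_sum, Finset.sum_apply,
    PiLp.single_apply] at h2
  rw [Matrix.one_apply, ← h2]
  exact Finset.sum_congr rfl fun i _ => mul_comm _ _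

variable [IsManifold (𝓡 4) ∞ X]

theorem isCoord_chartAt (p : X) : IsCoord (chartAt R4 p) :=
  IsManifold.chart_mem_maximalAtlas p

/-- A convergent family of tangent vectors has convergent coordinates. -/
theorem IsCoord.tendsto_coordDiff (he : IsCoord e) (hp : p ∈ e.source) {ι : Type*} {l : Filter ι}
    {F : ι → TangentBundle (𝓡 4) X} {v : TangentSpace (𝓡 4) p}
    (hF : Filter.Tendsto F l (𝓝 (⟨p, v⟩ : TangentBundle (𝓡 4) X))) :
    Filter.Tendsto (fun i => coordDiff e (F i).1 (F i).2) l (𝓝 (coordDiff e p v)) := by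
  have h1 := (contMDiffOn_of_mem_maximalAtlas he).continuousOn_tangentMapWithin (by simp)
    e.open_source.uniqueMDiffOn
  have hop : IsOpen (Bundle.TotalSpace.proj ⁻¹' e.source : Set (TangentBundle (𝓡 4) X)) :=
    e.open_source.preimage (FiberBundle.continuous_proj R4 (TangentSpace (𝓡 4) : X → Type))
  have h2 := h1.continuousAt (hop.mem_nhds (show (⟨p, v⟩ : TangentBundle (𝓡 4) X) ∈ _ from hp))
  have h3 : Continuous fun x : TangentBundle (𝓡 4) R4 => (x.2 : R4) :=
    continuous_snd.comp (tangentBundleModelSpaceHomeomorph (𝓡 4)).continuous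
  have h4 := (h3.tendsto _).comp (h2.tendsto.comp hF)
  have h5 : ∀ x : TangentBundle (𝓡 4) X, x.1 ∈ e.source →
      ((tangentMapWithin (𝓡 4) (𝓡 4) e e.source x).2 : R4) = coordDiff e x.1 x.2 := by
    intro x hx
    rw [tangentMapWithin_eq_tangentMap (e.open_source.uniqueMDiffWithinAt hx)
      (he.mdifferentiableAt hx)]
    rfl
  rw [h5 _ hp] at h4
  refine h4.congr' ?_
  filter_upwards [hF (hop.mem_nhds (show (⟨p, v⟩ : TangentBundle (𝓡 4) X) ∈ _ from hp))] with i hi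
  exact h5 _ hi

/-- The push-forward of a fixed vector is a continuous function of the point. -/
theorem IsCoord.continuousAt_coordPush (he : IsCoord e) (hp : p ∈ e.source) (w : R4) :
    ContinuousAt (fun q => (⟨q, coordPush e q w⟩ : TangentBundle (𝓡 4) X)) p := by
  have h1 := (contMDiffOn_symm_of_mem_maximalAtlas he).continuousOn_tangentMapWithin (by simp)
    e.open_target.uniqueMDiffOn
  have hop : IsOpen (Bundle.TotalSpace.proj ⁻¹' e.target : Set (TangentBundle (𝓡 4) R4)) :=
    e.open_target.preimage (FiberBundle.continuous_proj R4 (TangentSpace (𝓡 4) : R4 → Type))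
  have hm := e.map_source hp
  have h2 := h1.continuousAt (hop.mem_nhds (show (⟨e p, w⟩ : TangentBundle (𝓡 4) R4) ∈ _ from hm))
  have h3 : Continuous fun y : R4 => (⟨y, w⟩ : TangentBundle (𝓡 4) R4) :=
    (tangentBundleModelSpaceHomeomorph (𝓡 4)).symm.continuous.comp
      (Continuous.prodMk continuous_id continuous_const)
  have h4 : ContinuousAt (fun q => tangentMapWithin (𝓡 4) (𝓡 4) e.symm e.target
      (⟨e q, w⟩ : TangentBundle (𝓡 4) R4)) p :=
    ContinuousAt.comp (f := fun q => (⟨e q, w⟩ : TangentBundle (𝓡 4) R4)) h2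
      (ContinuousAt.comp (f := e) h3.continuousAt (e.continuousAt hp))
  refine h4.congr ?_
  filter_upwards [e.open_source.mem_nhds hp] with q hq
  rw [tangentMapWithin_eq_tangentMap (e.open_target.uniqueMDiffWithinAt (e.map_source hq))
      (he.mdifferentiableAt_symm (e.map_source hq))]
  have : ∀ q', q' = q → (⟨q', (mfderiv (𝓡 4) (𝓡 4) e.symm (e q) : R4 →L[ℝ] R4) w⟩ :
      TangentBundle (𝓡 4) X) = ⟨q, coordPush e q w⟩ := by rintro q' rfl; rfl
  exact this _ (e.left_inv hq)

theorem IsCoord.continuousAt_transition (he : IsCoord e) (he' : IsCoord e') (hp : p ∈ e.source)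
    (hp' : p ∈ e'.source) : ContinuousAt (transition e e') p := by
  refine tendsto_matrix_iff.2 fun ν μ => ?_
  have h := he.tendsto_coordDiff hp
    (he'.continuousAt_coordPush hp' (EuclideanSpace.single μ 1)).tendsto
  exact ((EuclideanSpace.proj (𝕜 := ℝ) ν).continuous.tendsto _).comp h

/-- The `g`-trace may be computed in any chart. -/
theorem IsCoord.trg_eq (he : IsCoord e) (hp : p ∈ e.source) (g S : Tensor2 X) :
    trg g S p = ((compMatrix g e p)⁻¹ * (compMatrix S e p).transpose).trace := by
  set c := chartAt R4 p with hc
  have hcp : p ∈ c.source := mem_chart_source R4 p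
  have hcc : IsCoord c := isCoord_chartAt p
  have h0 : trg g S p = ((compMatrix g c p)⁻¹ * (compMatrix S c p).transpose).trace := by
    have h1 : coordMatrix g c (c p) = compMatrix g c p := by
      ext μ ν
      simp only [coordMatrix, compMatrix, Matrix.of_apply]
      rw [c.left_inv hcp]
    simp only [trg, Matrix.trace, Matrix.diag, Matrix.mul_apply, Matrix.transpose_apply, ← hc, h1]
    rfl
  have hA := he.transition_mul hcc hp hcp
  rw [h0, he.compMatrix_change (e' := c) hp g, he.compMatrix_change (e' := c) hp S]
  set P := transition e c p
  rw [Matrix.mul_inv_rev, Matrix.mul_inv_rev]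
  simp only [Matrix.transpose_mul, Matrix.transpose_transpose]
  have hP : IsUnit P.det := (Matrix.isUnit_iff_isUnit_det P).1 (.of_mul_eq_one _ hA)
  have hPt : IsUnit P.transpose.det := by rwa [Matrix.det_transpose]
  calc _ = (P⁻¹ * ((compMatrix g e p)⁻¹ * (P.transpose⁻¹ * P.transpose) *
      (compMatrix S e p).transpose * P)).trace := by
        simp only [Matrix.mul_assoc]
    _ = _ := by
        rw [Matrix.nonsing_inv_mul _ hPt, Matrix.trace_mul_comm, Matrix.mul_one,
          Matrix.mul_assoc, Matrix.mul_nonsing_inv _ hP, Matrix.mul_one]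

/-- A continuously extendible tensor has convergent components in every chart. -/
theorem TensorExtends.tendsto {M : Set X} {O : X} {S : Tensor2 X}
    {B : LinearMap.BilinForm ℝ (TangentSpace (𝓡 4) O)} (h : TensorExtends M O S B) (hO : O ∉ M)
    (he : IsCoord e) (hp : O ∈ e.source) :
    Filter.Tendsto (compMatrix S e) (𝓝[M] O)
      (𝓝 (Matrix.of fun μ ν => B (coordVec e μ O) (coordVec e ν O))) := by
  classical
  obtain ⟨c, hc, hcO, hcomp⟩ := h
  have h1 : Filter.Tendsto (compMatrix S c) (𝓝[M] O)
      (𝓝 (Matrix.of fun μ ν => B (coordVec c μ O) (coordVec c ν O))) := by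
    refine tendsto_matrix_iff.2 fun μ ν => ?_
    have h2 := (hcomp μ ν).tendsto (fun hh => hO hh.2)
    rwa [Set.inter_comm, nhdsWithin_inter_of_mem'
      (mem_nhdsWithin_of_mem_nhds (c.open_source.mem_nhds hcO))] at h2
  let B' : Tensor2 X := fun q => if hq : q = O then hq ▸ B else 0
  have hB' : B' O = B := by simp [B']
  have h3 : ∀ c' : OpenPartialHomeomorph X R4, (Matrix.of fun μ ν =>
      B (coordVec c' μ O) (coordVec c' ν O)) = compMatrix B' c' O := by
    intro c'; ext μ ν; simp [compMatrix, comp, hB']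
  rw [h3] at h1 ⊢
  rw [hc.compMatrix_change hcO B']
  have ht : Filter.Tendsto (transition c e) (𝓝[M] O) (𝓝 (transition c e O)) :=
    (hc.continuousAt_transition he hcO hp).tendsto.mono_left nhdsWithin_le_nhds
  have htt : Filter.Tendsto (fun q => (transition c e q).transpose) (𝓝[M] O)
      (𝓝 (transition c e O).transpose) :=
    ((continuous_id.matrix_transpose).tendsto _).comp ht
  refine ((htt.mul h1).mul ht).congr' ?_
  filter_upwards [mem_nhdsWithin_of_mem_nhds (c.open_source.mem_nhds hcO)] with q hq
  exact (hc.compMatrix_change hq S).symm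

end ChartCalculus

section Curves

variable {X : Type*} [TopologicalSpace X] [ChartedSpace R4 X]
  {e : OpenPartialHomeomorph X R4} {p : X}

theorem HasVelocityWithin.hasDerivWithinAt (he : IsCoord e) {γ : ℝ → X} {s : Set ℝ} {t : ℝ}
    {v : TangentSpace (𝓡 4) p} (h : HasVelocityWithin γ s t p v) (hp : p ∈ e.source) :
    HasDerivWithinAt (fun r => e (γ r)) (coordDiff e p v) s t := by
  obtain ⟨rfl, h⟩ := h
  have h1 := (he.mdifferentiableAt hp).hasMFDerivAt.comp_hasMFDerivWithinAt t h
  have h2 : HasFDerivWithinAt (fun r => e (γ r)) ((coordDiff e (γ t) : R4 →L[ℝ] R4).comp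
      ((1 : ℝ →L[ℝ] ℝ).smulRight (v : R4))) s t := hasMFDerivWithinAt_iff_hasFDerivWithinAt.1 h1
  have h3 := h2.hasDerivWithinAt
  rw [ContinuousLinearMap.comp_apply, ContinuousLinearMap.smulRight_apply,
    one_apply_eq_self] at h3
  have h4 : ((1 : ℝ) • (v : R4)) = v := one_smul ℝ _
  rw [h4] at h3
  exact h3

theorem HasVelocityWithin.congr {γ γ' : ℝ → X} {s s' : Set ℝ} {t : ℝ}
    {v : TangentSpace (𝓡 4) p} (h : HasVelocityWithin γ s t p v) (hs : s ∈ 𝓝[s'] t)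
    (hγ : Set.EqOn γ' γ s) (ht : γ' t = γ t) : HasVelocityWithin γ' s' t p v := by
  obtain ⟨rfl, h⟩ := h
  refine ⟨ht, ?_⟩
  have h1 := h.mono_of_mem_nhdsWithin hs
  have h2 : γ' =ᶠ[𝓝[s'] t] γ := by filter_upwards [hs] with r hr using hγ hr
  have h3 := h1.congr_of_eventuallyEq h2 ht
  exact h3

theorem HasVelocityWithin.unique {γ : ℝ → X} {s : Set ℝ} {t : ℝ} {v w : TangentSpace (𝓡 4) p}
    (hs : UniqueDiffWithinAt ℝ s t) (hv : HasVelocityWithin γ s t p v)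
    (hw : HasVelocityWithin γ s t p w) : v = w := by
  obtain ⟨rfl, hv⟩ := hv
  have h := UniqueMDiffWithinAt.eq (uniqueMDiffWithinAt_iff_uniqueDiffWithinAt.2 hs) hv hw.2
  have h2 := congrArg (fun L : ℝ →L[ℝ] R4 => L 1) h
  have h3 : ((1 : ℝ →L[ℝ] ℝ).smulRight (v : R4)) 1 = ((1 : ℝ →L[ℝ] ℝ).smulRight (w : R4)) 1 := h2
  simpa using h3

/-- A union of a chain of integral curves extends to a maximal integral curve. -/
theorem IsIntegralIn.exists_isMaxIntegralIn {M : Set X} {u : VField X} {γ₀ : ℝ → X} {J₀ : Set ℝ}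
    (h₀ : IsIntegralIn M u γ₀ J₀) :
    ∃ γ J, IsMaxIntegralIn M u γ J ∧ J₀ ⊆ J ∧ Set.EqOn γ γ₀ J₀ := by
  classical
  let A := {x : Set ℝ × (ℝ → X) // IsIntegralIn M u x.2 x.1 ∧ J₀ ⊆ x.1 ∧ Set.EqOn x.2 γ₀ J₀}
  let r : A → A → Prop := fun x y => x.1.1 ⊆ y.1.1 ∧ Set.EqOn y.1.2 x.1.2 x.1.1
  have hr : ∀ x, r x x := fun x => ⟨subset_rfl, fun _ _ => rfl⟩
  obtain ⟨⟨⟨J, γ⟩, hint, hsub, heq⟩, hmax⟩ : ∃ m : A, ∀ x, r m x → r x m := by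
    refine exists_maximal_of_chains_bounded (r := r) (fun c hc => ?_)
      (fun {x y z} hxy hyz => ⟨hxy.1.trans hyz.1,
        fun t ht => (hyz.2 (hxy.1 ht)).trans (hxy.2 ht)⟩)
    rcases c.eq_empty_or_nonempty with rfl | ⟨x₀, hx₀⟩
    · exact ⟨⟨(J₀, γ₀), h₀, subset_rfl, fun _ _ => rfl⟩, by simp⟩
    have htot : ∀ x ∈ c, ∀ y ∈ c, r x y ∨ r y x := by
      intro x hx y hy
      by_cases hxy : x = y
      · exact Or.inl (hxy ▸ hr x)
      · exact hc hx hy hxy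
    let Js : Set ℝ := ⋃ x ∈ c, x.1.1
    let γs : ℝ → X := fun t => if h : ∃ x ∈ c, t ∈ x.1.1 then h.choose.1.2 t else γ₀ t
    have hγs : ∀ x ∈ c, Set.EqOn γs x.1.2 x.1.1 := by
      intro x hx t ht
      have h : ∃ x ∈ c, t ∈ x.1.1 := ⟨x, hx, ht⟩
      simp only [γs, dif_pos h]
      obtain ⟨hc1, hc2⟩ := h.choose_spec
      rcases htot _ hc1 x hx with h1 | h1
      · exact (h1.2 hc2).symm
      · exact h1.2 ht
    have hJs : ∀ x ∈ c, x.1.1 ⊆ Js := fun x hx t ht => Set.mem_biUnion hx ht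
    have hmem : ∀ t ∈ Js, ∃ x ∈ c, t ∈ x.1.1 := fun t ht => by simpa [Js] using ht
    refine ⟨⟨(Js, γs), ⟨isOpen_biUnion fun x _ => x.2.1.1, ⟨?_⟩, ?_, ?_⟩, ?_, ?_⟩, ?_⟩
    · intro s hs t ht
      obtain ⟨x, hx, hsx⟩ := hmem s hs
      obtain ⟨y, hy, hty⟩ := hmem t ht
      rcases htot x hx y hy with h | h
      · exact (y.2.1.2.1.out (h.1 hsx) hty).trans (hJs y hy)
      · exact (x.2.1.2.1.out hsx (h.1 hty)).trans (hJs x hx)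
    · exact h₀.2.2.1.mono (x₀.2.2.1.trans (hJs x₀ hx₀))
    · intro t ht
      obtain ⟨x, hx, htx⟩ := hmem t ht
      have h1 := x.2.1.2.2.2 t htx
      have h2 : γs t = x.1.2 t := hγs x hx htx
      change γs t ∈ M ∧ HasVelocityWithin γs Js t (γs t) (u (γs t))
      rw [h2]
      exact ⟨h1.1, h1.2.congr (mem_nhdsWithin_of_mem_nhds (x.2.1.1.mem_nhds htx))
        (hγs x hx) h2⟩
    · exact x₀.2.2.1.trans (hJs x₀ hx₀)
    · intro t ht
      exact (hγs x₀ hx₀ (x₀.2.2.1 ht)).trans (x₀.2.2.2 ht)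
    · exact fun x hx => ⟨hJs x hx, hγs x hx⟩
  refine ⟨γ, J, ⟨hint, fun δ J' hδ hJ hEq => ?_⟩, hsub, heq⟩
  exact Set.Subset.antisymm (hmax ⟨(J', δ), hδ, hsub.trans hJ,
    fun t ht => (hEq (hsub ht)).trans (heq ht)⟩ ⟨hJ, hEq⟩).1 hJ

variable [IsManifold (𝓡 4) ∞ X]

/-- A curve with continuous velocity is locally Lipschitz. -/
theorem locLipschitz_of_continuous_velocity {γ : ℝ → X} {a b : ℝ}
    {V : ∀ t, TangentSpace (𝓡 4) (γ t)}
    (hV : ∀ t ∈ Set.Icc a b, HasVelocityWithin γ (Set.Icc a b) t (γ t) (V t))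
    (hc : ∀ t ∈ Set.Icc a b, Filter.Tendsto (fun r => (⟨γ r, V r⟩ : TangentBundle (𝓡 4) X))
      (𝓝[Set.Icc a b] t) (𝓝 ⟨γ t, V t⟩)) : LocLipschitz γ a b := by
  have hcont : ContinuousOn γ (Set.Icc a b) := fun t ht => (hV t ht).2.continuousWithinAt
  refine ⟨hcont, fun t ht => ?_⟩
  set c := chartAt R4 (γ t)
  have hcc : IsCoord c := isCoord_chartAt (γ t)
  have hct : γ t ∈ c.source := mem_chart_source R4 (γ t)
  have h1 := (hcc.tendsto_coordDiff hct (hc t ht)).nnnorm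
  set K : NNReal := ‖coordDiff c (γ t) (V t)‖₊ + 1
  have h2 : ∀ᶠ r in 𝓝[Set.Icc a b] t, ‖coordDiff c (γ r) (V r)‖₊ < K ∧ γ r ∈ c.source :=
    (h1.eventually (gt_mem_nhds (lt_add_one _))).and
      ((hcont t ht).eventually (c.open_source.mem_nhds hct))
  obtain ⟨ε, hε, hball⟩ := Metric.mem_nhdsWithin_iff.1 h2
  refine ⟨K, Metric.ball t ε ∩ Set.Icc a b,
    Filter.inter_mem (mem_nhdsWithin_of_mem_nhds (Metric.ball_mem_nhds t hε))
      self_mem_nhdsWithin, ?_⟩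
  refine Convex.lipschitzOnWith_of_nnnorm_hasDerivWithin_le
    (f' := fun r => coordDiff c (γ r) (V r))
    ((convex_ball t ε).inter (convex_Icc a b)) (fun r hr => ?_) (fun r hr => (hball hr).1.le)
  exact ((hV r hr.2).hasDerivWithinAt hcc (hball hr).2).mono Set.inter_subset_right

/-- Through every point of `M` there is a maximal integral curve. -/
theorem exists_isMaxIntegralIn {M : Set X} (hM : IsOpen M) {u : VField X} (hu : IsC1FieldOn u M)
    {q : X} (hq : q ∈ M) : ∃ γ J t, IsMaxIntegralIn M u γ J ∧ t ∈ J ∧ γ t = q := by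
  have : IsManifold (𝓡 4) 1 X := IsManifold.of_le (n := ∞) (by simp)
  have hu' := (hu q hq).contMDiffAt (hM.mem_nhds hq)
  obtain ⟨γ₀, h0, hγ₀⟩ :=
    exists_isMIntegralCurveAt_of_contMDiffAt_boundaryless (t₀ := 0) hu'
  have hc : ContinuousAt γ₀ 0 := hγ₀.self_of_nhds.continuousAt
  have hev := hγ₀.and (hc.eventually (hM.mem_nhds (by rwa [h0])))
  obtain ⟨ε, hε, hball⟩ := Metric.eventually_nhds_iff_ball.1 hev
  have hint : IsIntegralIn M u γ₀ (Metric.ball 0 ε) :=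
    ⟨Metric.isOpen_ball, by rw [Real.ball_eq_Ioo]; exact Set.ordConnected_Ioo,
      ⟨0, Metric.mem_ball_self hε⟩,
      fun t ht => ⟨(hball t ht).2, rfl, (hball t ht).1.hasMFDerivWithinAt⟩⟩
  obtain ⟨γ, J, hmax, hsub, heq⟩ := hint.exists_isMaxIntegralIn
  exact ⟨γ, J, 0, hmax, hsub (Metric.mem_ball_self hε),
    (heq (Metric.mem_ball_self hε)).trans h0⟩

end Curves

section Future

variable {X : Type*} [TopologicalSpace X] [ChartedSpace R4 X]
  {e : OpenPartialHomeomorph X R4}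

theorem ofComp_apply (p : X) (A : Matrix (Fin 4) (Fin 4) ℝ) (v w : TangentSpace (𝓡 4) p) :
    ofComp e p A v w = ∑ i, ∑ j, (coordDiff e p v) i * A i j * (coordDiff e p w) j := by
  have h : ∀ x y : R4, Matrix.toBilin (EuclideanSpace.basisFun (Fin 4) ℝ).toBasis A x y =
      ∑ i, ∑ j, x i * A i j * y j := by
    intro x y
    rw [Matrix.toBilin_apply]
    simp
  exact h _ _

theorem narrowMetric_apply (ε : ℝ) (p : X) (v w : TangentSpace (𝓡 4) p) :
    narrowMetric ε e p v w = -(ε / (2 - ε)) * ((coordDiff e p v) 0 * (coordDiff e p w) 0)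
      + (coordDiff e p v) 1 * (coordDiff e p w) 1 + (coordDiff e p v) 2 * (coordDiff e p w) 2
      + (coordDiff e p v) 3 * (coordDiff e p w) 3 := by
  rw [narrowMetric, ofComp_apply]
  simp only [Matrix.of_apply, narrowEta, Fin.sum_univ_four]
  simp
  ring

variable [IsManifold (𝓡 4) ∞ X]

/-- A straight segment in a chart whose direction is `narrowMetric`-timelike runs into the
timelike future of its starting point. -/
theorem eventually_mem_timelikeFuture (he : IsCoord e) {O : X} (hO : O ∈ e.source) (h0 : e O = 0)
    {ε : ℝ} (hε : 0 < ε) (hε2 : ε < 2) {w : R4} (hw0 : 0 < w 0)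
    (hw : w 1 * w 1 + w 2 * w 2 + w 3 * w 3 < ε / (2 - ε) * (w 0 * w 0)) :
    ∀ᶠ s : ℝ in 𝓝[>] 0, e.symm (s • w) ∈
      timelikeFuture (narrowMetric ε e) (coordVec e 0) O e.source := by
  have hc0 : 0 < ε / (2 - ε) := div_pos hε (by linarith)
  have h0t : (0 : R4) ∈ e.target := h0 ▸ e.map_source hO
  have hcont : Continuous fun s : ℝ => s • w := by fun_prop
  have hopen : IsOpen {s : ℝ | s • w ∈ e.target} := e.open_target.preimage hcont
  obtain ⟨r, hr, hball⟩ := Metric.isOpen_iff.1 hopen 0 (by simpa using h0t)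
  filter_upwards [Ioo_mem_nhdsGT hr] with s hs
  have hseg : ∀ t ∈ Set.Icc 0 s, t • w ∈ e.target := fun t ht => hball (by
    rw [Metric.mem_ball, Real.dist_eq, sub_zero, abs_lt]
    constructor <;> linarith [ht.1, ht.2, hs.1, hs.2])
  set γ : ℝ → X := fun t => e.symm (t • w)
  have hγ : ∀ t ∈ Set.Icc 0 s, γ t ∈ e.source := fun t ht => e.map_target (hseg t ht)
  let V : ∀ t, TangentSpace (𝓡 4) (γ t) := fun t => coordPush e (γ t) w
  have hV : ∀ t ∈ Set.Icc 0 s, HasVelocityWithin γ (Set.Icc 0 s) t (γ t) (V t) := by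
    intro t ht
    refine ⟨rfl, HasMFDerivAt.hasMFDerivWithinAt ?_⟩
    have h1 : HasDerivAt (fun t : ℝ => t • w) w t := by
      simpa using (hasDerivAt_id t).smul_const w
    have h2 : HasMFDerivAt 𝓘(ℝ, ℝ) (𝓡 4) (fun t : ℝ => t • w) t
        ((1 : ℝ →L[ℝ] ℝ).smulRight w) := h1.hasFDerivAt.hasMFDerivAt
    have h3 := (he.mdifferentiableAt_symm (hseg t ht)).hasMFDerivAt.comp t h2
    refine h3.congr_mfderiv ?_
    have h4 : (V t : R4) = (mfderiv (𝓡 4) (𝓡 4) e.symm (t • w) : R4 →L[ℝ] R4) w := by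
      change (mfderiv (𝓡 4) (𝓡 4) e.symm (e (γ t)) : R4 →L[ℝ] R4) w = _
      rw [e.right_inv (hseg t ht)]
    rw [h4]
    refine ContinuousLinearMap.ext fun (x : ℝ) => ?_
    exact (mfderiv (𝓡 4) (𝓡 4) e.symm (t • w) : R4 →L[ℝ] R4).map_smul x w
  have hcV : ∀ t ∈ Set.Icc 0 s, Filter.Tendsto (fun r => (⟨γ r, V r⟩ : TangentBundle (𝓡 4) X))
      (𝓝[Set.Icc 0 s] t) (𝓝 ⟨γ t, V t⟩) := fun t ht =>
    (he.continuousAt_coordPush (hγ t ht) w).tendsto.comp (hV t ht).2.continuousWithinAt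
  refine ⟨γ, 0, s, hs.1, ⟨locLipschitz_of_continuous_velocity hV hcV,
    (ε / (2 - ε) * (w 0 * w 0) - (w 1 * w 1 + w 2 * w 2 + w 3 * w 3)) / 2, by linarith,
    Filter.Eventually.of_forall fun t ht => ⟨V t, hV t ht, ?_, ?_⟩⟩, hγ, ?_, rfl⟩
  · simp only [narrowMetric_apply, V, he.coordDiff_coordPush (hγ t ht)]
    linarith
  · simp only [narrowMetric_apply, V, coordVec_eq_coordPush, he.coordDiff_coordPush (hγ t ht)]
    simpa using mul_pos hc0 hw0
  · simp [γ, ← h0, e.left_inv hO]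

end Future

section OriginPoint

variable {X : Type*} [TopologicalSpace X] [ChartedSpace R4 X]

theorem IsIntegralIn.Ioc_subset {M : Set X} {u : VField X} {γ : ℝ → X} {J : Set ℝ} {a b : ℝ}
    (h : IsIntegralIn M u γ J) (ha : IsGLB J a) (hb : b ∈ J) : a < b ∧ Set.Ioc a b ⊆ J := by
  refine ⟨lt_of_le_of_ne (ha.1 hb) ?_, fun t ht => ?_⟩
  · rintro rfl
    obtain ⟨r, hr, hball⟩ := Metric.isOpen_iff.1 h.1 a hb
    have h1 : a - r / 2 ∈ J := hball (by
      rw [Metric.mem_ball, Real.dist_eq, abs_lt]; constructor <;> linarith)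
    linarith [ha.1 h1]
  · obtain ⟨s, hs, -, hst⟩ := ha.exists_between ht.1
    exact h.2.1.out hs hb ⟨hst.le, ht.2⟩

theorem tangentBundle_mk_eq {p q : X} {v w : R4} (h : p = q) (h' : v = w) :
    (⟨p, v⟩ : TangentBundle (𝓡 4) X) = ⟨q, w⟩ := by
  subst h h'; rfl

variable [IsManifold (𝓡 4) ∞ X]

/-- An integral curve with a velocity limit at its origin extends to a locally Lipschitz curve. -/
theorem IsIntegralIn.locLipschitz_extendCurve {M : Set X} (hM : IsOpen M) {u : VField X}
    (hu : IsC1FieldOn u M) {γ : ℝ → X} {J : Set ℝ} {a b : ℝ} {O : X}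
    (h : IsIntegralIn M u γ J) (ha : IsGLB J a) (hb : b ∈ J) {v : TangentSpace (𝓡 4) O}
    (hv : HasVelocityWithin (extendCurve γ a O) (Set.Ici a) a O v)
    (hlim : Filter.Tendsto (fun t => (⟨γ t, u (γ t)⟩ : TangentBundle (𝓡 4) X)) (𝓝[>] a)
      (𝓝 (⟨O, v⟩ : TangentBundle (𝓡 4) X))) :
    LocLipschitz (extendCurve γ a O) a b ∧ ∀ t ∈ Set.Ioc a b,
      HasVelocityWithin (extendCurve γ a O) (Set.Icc a b) t (extendCurve γ a O t)
        (u (extendCurve γ a O t)) := by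
  classical
  obtain ⟨hab, hsub⟩ := h.Ioc_subset ha hb
  set δ := extendCurve γ a O with hδ
  have hδa : δ a = O := by rw [hδ, extendCurve]; exact Function.update_self ..
  have hδt : ∀ t, t ≠ a → δ t = γ t := fun t ht => by
    rw [hδ, extendCurve]; exact Function.update_of_ne ht ..
  have hvel : ∀ t ∈ Set.Ioc a b, HasVelocityWithin δ (Set.Icc a b) t (δ t) (u (δ t)) := by
    intro t ht
    have hJt : J ∩ Set.Ioi a ∈ 𝓝 t :=
      Filter.inter_mem (h.1.mem_nhds (hsub ht)) (Ioi_mem_nhds ht.1)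
    have h1 := (h.2.2.2 t (hsub ht)).2
    rw [hδt t ht.1.ne']
    exact HasVelocityWithin.congr (s := J ∩ Set.Ioi a)
      ⟨h1.1, h1.2.mono Set.inter_subset_left⟩
      (mem_nhdsWithin_of_mem_nhds hJt) (fun r hr => hδt r hr.2.ne') (hδt t ht.1.ne')
  let V : ∀ t, TangentSpace (𝓡 4) (δ t) :=
    fun t => (if t = a then (v : R4) else (u (δ t) : R4) : R4)
  have hVa : (⟨δ a, V a⟩ : TangentBundle (𝓡 4) X) = ⟨O, v⟩ :=
    tangentBundle_mk_eq hδa (if_pos rfl)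
  have hVt : ∀ t, t ≠ a → V t = u (δ t) := fun t ht => if_neg ht
  have hVt' : ∀ t, t ≠ a → (⟨δ t, V t⟩ : TangentBundle (𝓡 4) X) = ⟨γ t, u (γ t)⟩ := fun t ht => by
    rw [hVt t ht, hδt t ht]
  refine ⟨locLipschitz_of_continuous_velocity (V := V) (fun t ht => ?_) (fun t ht => ?_), hvel⟩
  · rcases eq_or_ne t a with rfl | hta
    · have h1 : ∀ (q : X) (w : R4), q = O → w = v → HasVelocityWithin δ (Set.Icc t b) t q w := by
        rintro q w rfl rfl
        exact ⟨hv.1, hv.2.mono fun r hr => hr.1⟩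
      exact h1 _ _ hδa (if_pos rfl)
    · rw [hVt t hta]
      exact hvel t ⟨lt_of_le_of_ne ht.1 hta.symm, ht.2⟩
  · rcases eq_or_ne t a with rfl | hta
    · rw [← Set.Ioc_insert_left hab.le, nhdsWithin_insert, Filter.tendsto_sup]
      refine ⟨tendsto_pure_nhds _ _, ?_⟩
      rw [hVa]
      refine (hlim.mono_left (nhdsWithin_mono _ fun r hr => hr.1)).congr' ?_
      filter_upwards [self_mem_nhdsWithin] with r hr
      exact (hVt' r hr.1.ne').symm
    · have ht' : t ∈ Set.Ioc a b := ⟨lt_of_le_of_ne ht.1 hta.symm, ht.2⟩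
      have h1 : ContinuousAt γ t :=
        ((h.2.2.2 t (hsub ht')).2.2.hasMFDerivAt (h.1.mem_nhds (hsub ht'))).continuousAt
      have h2 := (hu.continuousOn.continuousAt
        (hM.mem_nhds (h.2.2.2 t (hsub ht')).1)).tendsto.comp h1.tendsto
      rw [hVt' t hta]
      refine (h2.mono_left nhdsWithin_le_nhds).congr' ?_
      filter_upwards [mem_nhdsWithin_of_mem_nhds (Ioi_mem_nhds ht'.1)] with r hr
      exact (hVt' r (ne_of_gt hr)).symm

end OriginPoint

section Limit

variable {X : Type*} [TopologicalSpace X] [ChartedSpace R4 X]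
  {e : OpenPartialHomeomorph X R4}

/-- The tensor `u_* ⊗ u_*`. -/
def dualSquare (g : Tensor2 X) (u : VField X) : Tensor2 X := fun p =>
  LinearMap.BilinForm.linMulLin (g p (u p)) (g p (u p))

/-- The coordinate matrix `u^μ u^ν`. -/
def coordSquare (u : VField X) (e : OpenPartialHomeomorph X R4) (p : X) :
    Matrix (Fin 4) (Fin 4) ℝ :=
  Matrix.of fun μ ν => (coordDiff e p (u p)) μ * (coordDiff e p (u p)) ν

theorem IsCoord.compMatrix_dualSquare (he : IsCoord e) {p : X} (hp : p ∈ e.source) (g : Tensor2 X)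
    (u : VField X) : compMatrix (dualSquare g u) e p =
      (compMatrix g e p).transpose * coordSquare u e p * compMatrix g e p := by
  ext μ ν
  have h : ∀ μ, g p (u p) (coordVec e μ p) =
      ∑ i, (coordDiff e p (u p)) i * g p (coordVec e i p) (coordVec e μ p) := by
    intro μ
    conv_lhs => rw [he.sum_coordVec hp (u p)]
    simp only [map_sum, map_smul, LinearMap.sum_apply, LinearMap.smul_apply, smul_eq_mul]
  simp only [compMatrix, comp, Matrix.of_apply, Matrix.mul_apply, Matrix.transpose_apply,
    coordSquare, dualSquare, LinearMap.BilinForm.linMulLin_apply]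
  rw [h μ, h ν]
  simp only [Finset.sum_mul, Finset.mul_sum]
  refine Finset.sum_congr rfl fun i _ => Finset.sum_congr rfl fun j _ => ?_
  ring

theorem tendsto_inv_matrix {ι : Type*} {l : Filter ι} {F : ι → Matrix (Fin 4) (Fin 4) ℝ}
    {A : Matrix (Fin 4) (Fin 4) ℝ} (hF : Filter.Tendsto F l (𝓝 A)) (hA : A.det ≠ 0) :
    Filter.Tendsto (fun i => (F i)⁻¹) l (𝓝 A⁻¹) := by
  have h1 : Filter.Tendsto (fun i => (F i).det) l (𝓝 A.det) :=
    (continuous_id.matrix_det.tendsto A).comp hF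
  have h2 : Filter.Tendsto (fun i => (F i).adjugate) l (𝓝 A.adjugate) :=
    (continuous_id.matrix_adjugate.tendsto A).comp hF
  simp only [Matrix.inv_def, Ring.inverse_eq_inv']
  exact (h1.inv₀ hA).smul h2

theorem tendsto_transpose {ι : Type*} {l : Filter ι} {F : ι → Matrix (Fin 4) (Fin 4) ℝ}
    {A : Matrix (Fin 4) (Fin 4) ℝ} (hF : Filter.Tendsto F l (𝓝 A)) :
    Filter.Tendsto (fun i => (F i).transpose) l (𝓝 A.transpose) :=
  (continuous_id.matrix_transpose.tendsto A).comp hF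

theorem tendsto_trace {ι : Type*} {l : Filter ι} {F : ι → Matrix (Fin 4) (Fin 4) ℝ}
    {A : Matrix (Fin 4) (Fin 4) ℝ} (hF : Filter.Tendsto F l (𝓝 A)) :
    Filter.Tendsto (fun i => (F i).trace) l (𝓝 A.trace) :=
  (continuous_id.matrix_trace.tendsto A).comp hF

theorem eta_mul_eta : Matrix.of eta * Matrix.of eta = 1 := by
  ext μ ν
  fin_cases μ <;> fin_cases ν <;> simp [Matrix.mul_apply, eta]

theorem det_eta_ne_zero : (Matrix.of eta).det ≠ 0 := by
  intro h
  have := congrArg Matrix.det eta_mul_eta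
  simp [h] at this

theorem inv_eta : (Matrix.of eta)⁻¹ = Matrix.of eta := Matrix.inv_eq_left_inv eta_mul_eta

/-- If `u_* ⊗ u_*` has convergent components then so has `u ⊗ u`. -/
theorem IsCoord.tendsto_coordSquare (he : IsCoord e) {O : X} (hO : O ∈ e.source) {M : Set X}
    {g : Tensor2 X} {u : VField X} {G L : Matrix (Fin 4) (Fin 4) ℝ} (hG0 : G.det ≠ 0)
    (hG : Filter.Tendsto (compMatrix g e) (𝓝[M] O) (𝓝 G))
    (hL : Filter.Tendsto (compMatrix (dualSquare g u) e) (𝓝[M] O) (𝓝 L)) :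
    Filter.Tendsto (coordSquare u e) (𝓝[M] O) (𝓝 (G.transpose⁻¹ * L * G⁻¹)) := by
  have h1 := ((tendsto_inv_matrix (tendsto_transpose hG)
    (by rwa [Matrix.det_transpose])).mul hL).mul (tendsto_inv_matrix hG hG0)
  refine h1.congr' ?_
  have h2 : ∀ᶠ p in 𝓝[M] O, (compMatrix g e p).det ≠ 0 :=
    ((continuous_id.matrix_det.tendsto G).comp hG).eventually_ne hG0
  filter_upwards [h2, mem_nhdsWithin_of_mem_nhds (e.open_source.mem_nhds hO)] with p hp hpe
  rw [he.compMatrix_dualSquare hpe]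
  have hu1 : IsUnit (compMatrix g e p).det := hp.isUnit
  have hu2 : IsUnit (compMatrix g e p).transpose.det := by rwa [Matrix.det_transpose]
  rw [← Matrix.mul_assoc, ← Matrix.mul_assoc, Matrix.nonsing_inv_mul _ hu2, Matrix.one_mul,
    Matrix.mul_assoc, Matrix.mul_nonsing_inv _ hu1, Matrix.mul_one]

variable [IsManifold (𝓡 4) ∞ X]

theorem IsCoord.compMatrix_energyMomentum (he : IsCoord e) {p : X} (hp : p ∈ e.source)
    (g : Tensor2 X) : compMatrix (energyMomentum g) e p = (1 / (8 * Real.pi)) •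
      (compMatrix (Ric g) e p - ((1 / 2) *
        ((compMatrix g e p)⁻¹ * (compMatrix (Ric g) e p).transpose).trace) • compMatrix g e p) := by
  rw [← he.trg_eq hp]
  ext μ ν
  simp [compMatrix, comp, energyMomentum]

/-- If the velocity field `u` were asymptotically `∂₀` near `O`, an integral curve through a
suitable point near `O` would have a tangent vector far from `∂₀`. -/
theorem not_tendsto_dualSquare [T2Space X] (S : Spacetime X) {M : Set X} (hM : IsOpen M)
    {u : VField X} (hu : IsObserverField S M u) {O : X} (hO : IsOriginPoint M u O)
    {γ : ℝ → X} {J : Set ℝ} {a ε : ℝ} (hγ : IsMaxIntegralIn M u γ J) (ha : IsGLB J a)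
    (hε : 0 < ε) (hε2 : ε < 2) (he : IsCoord e) (hOe : O ∈ e.source) (he0 : e O = 0)
    (hη : ∀ μ ν, comp S.g e μ ν O = eta μ ν)
    (hvel : HasVelocityWithin (extendCurve γ a O) (Set.Ici a) a O (coordVec e 0 O))
    (hfut : timelikeFuture (narrowMetric ε e) (coordVec e 0) O e.source ⊆ M)
    (hcausal : StronglyCausalAt S.g S.timeField O) (L : Matrix (Fin 4) (Fin 4) ℝ) :
    ¬ Filter.Tendsto (compMatrix (dualSquare S.g u) e) (𝓝[M] O) (𝓝 L) := by
  classical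
  intro hL
  have hG : Filter.Tendsto (compMatrix S.g e) (𝓝[M] O) (𝓝 (Matrix.of eta)) := by
    refine tendsto_matrix_iff.2 fun μ ν => ?_
    have h := ((S.continuous_metric e he μ ν).continuousAt (e.open_source.mem_nhds hOe)).tendsto
    rw [hη] at h
    exact h.mono_left nhdsWithin_le_nhds
  have hK := he.tendsto_coordSquare hOe det_eta_ne_zero hG hL
  set K := (Matrix.of eta).transpose⁻¹ * L * (Matrix.of eta)⁻¹
  obtain ⟨b, hb⟩ := hγ.1.2.2.1
  obtain ⟨hab, hsub⟩ := hγ.1.Ioc_subset ha hb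
  have hγM : Filter.Tendsto γ (𝓝[>] a) (𝓝[M] O) ∧ Filter.Tendsto
      (fun t => coordDiff e (γ t) (u (γ t))) (𝓝[>] a) (𝓝 (EuclideanSpace.single 0 1)) := by
    obtain ⟨a', ha', hlim, v, hv, hvlim⟩ := hO.2 γ J hγ
    obtain rfl := ha'.unique ha
    obtain rfl := hv.unique (uniqueDiffOn_Ici _ _ Set.self_mem_Ici) hvel
    refine ⟨tendsto_nhdsWithin_iff.2 ⟨hlim, ?_⟩, ?_⟩
    · filter_upwards [Ioc_mem_nhdsGT hab] with t ht using (hγ.1.2.2.2 t (hsub ht)).1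
    · have h := he.tendsto_coordDiff hOe hvlim
      rwa [coordVec_eq_coordPush, he.coordDiff_coordPush hOe] at h
  have hcoord : ∀ μ, Filter.Tendsto (fun t => (coordDiff e (γ t) (u (γ t))) μ) (𝓝[>] a)
      (𝓝 ((EuclideanSpace.single 0 1 : R4) μ)) := fun μ =>
    ((EuclideanSpace.proj (𝕜 := ℝ) μ).continuous.tendsto _).comp hγM.2
  have hKval : ∀ μ ν, K μ ν = (EuclideanSpace.single 0 1 : R4) μ *
      (EuclideanSpace.single 0 1 : R4) ν := fun μ ν =>
    tendsto_nhds_unique ((tendsto_matrix_iff.1 hK μ ν).comp hγM.1)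
      ((hcoord μ).mul (hcoord ν))
  have hc0 : 0 < ε / (2 - ε) := div_pos hε (by linarith)
  set k := Real.sqrt (ε / (2 - ε)) / 2 with hk
  have hk0 : 0 < k := by positivity
  have hkk : k * k < ε / (2 - ε) := by
    have := Real.mul_self_sqrt hc0.le
    rw [hk]; nlinarith
  have hne : ∀ᶠ p in 𝓝[M] O, (coordDiff e p (u p)) 1 - k * (coordDiff e p (u p)) 0 ≠ 0 := by
    have h1 : Filter.Tendsto (fun p => coordSquare u e p 1 1 - 2 * k * coordSquare u e p 0 1 +
        k * k * coordSquare u e p 0 0) (𝓝[M] O) (𝓝 (K 1 1 - 2 * k * K 0 1 + k * k * K 0 0)) :=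
      ((tendsto_matrix_iff.1 hK 1 1).sub ((tendsto_matrix_iff.1 hK 0 1).const_mul _)).add
        ((tendsto_matrix_iff.1 hK 0 0).const_mul _)
    have h2 : K 1 1 - 2 * k * K 0 1 + k * k * K 0 0 ≠ 0 := by
      simp [hKval, hk0.ne']
    filter_upwards [h1.eventually_ne h2] with p hp h0
    apply hp
    simp only [coordSquare, Matrix.of_apply]
    linear_combination ((coordDiff e p (u p)) 1 - k * (coordDiff e p (u p)) 0) * h0
  obtain ⟨W, hW, hWM⟩ := mem_nhdsWithin_iff_exists_mem_nhds_inter.1 hne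
  obtain ⟨V, hV, -, hVc⟩ := hcausal (W ∩ e.source)
    (Filter.inter_mem hW (e.open_source.mem_nhds hOe))
  set w : R4 := !₂[1, k, 0, 0]
  have hline : Filter.Tendsto (fun s : ℝ => e.symm (s • w)) (𝓝[>] 0) (𝓝 O) := by
    have h1 : Filter.Tendsto (fun s : ℝ => s • w) (𝓝[>] 0) (𝓝 (e O)) := by
      have h2 : Continuous fun s : ℝ => s • w := by fun_prop
      have h3 := h2.tendsto 0
      rw [zero_smul, ← he0] at h3
      exact h3.mono_left nhdsWithin_le_nhds
    have h4 := (e.continuousAt_symm (e.map_source hOe)).tendsto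
    rw [e.left_inv hOe] at h4
    exact h4.comp h1
  have htarget : ∀ᶠ s : ℝ in 𝓝[>] 0, s • w ∈ e.target := by
    have h2 : Continuous fun s : ℝ => s • w := by fun_prop
    refine (h2.tendsto 0).mono_left nhdsWithin_le_nhds
      (e.open_target.mem_nhds ?_)
    rw [zero_smul, ← he0]
    exact e.map_source hOe
  obtain ⟨s, hsV, hsF, hst⟩ := ((hline.eventually hV).and
    ((eventually_mem_timelikeFuture he hOe he0 hε hε2 (w := w) (by simp [w])
      (by simpa [w] using hkk)).and htarget)).exists
  set q := e.symm (s • w) with hq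
  have hqM : q ∈ M := hfut hsF
  obtain ⟨c, I, t₀, hc, ht₀, hct⟩ := exists_isMaxIntegralIn hM hu.1 hqM
  obtain ⟨a', ha', -, v, hv, hvlim⟩ := hO.2 c I hc
  obtain ⟨hat, hI⟩ := hc.1.Ioc_subset ha' ht₀
  obtain ⟨hlip, hcv⟩ := hc.1.locLipschitz_extendCurve hM hu.1 ha' ht₀ hv hvlim
  set δ := extendCurve c a' O with hδ
  have hδa : δ a' = O := by rw [hδ, extendCurve]; exact Function.update_self ..
  have hδt : ∀ t, t ≠ a' → δ t = c t := fun t ht => by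
    rw [hδ, extendCurve]; exact Function.update_of_ne ht ..
  have hδM : ∀ t ∈ Set.Ioc a' t₀, δ t ∈ M := fun t ht => by
    rw [hδt t ht.1.ne']; exact (hc.1.2.2.2 t (hI ht)).1
  have hδq : δ t₀ = q := by rw [hδt _ hat.ne', hct]
  have hmaps : Set.MapsTo δ (Set.Icc a' t₀) (W ∩ e.source) := by
    refine hVc δ a' t₀ hat ⟨hlip, ?_⟩ (hδa ▸ mem_of_mem_nhds hV) (hδq ▸ hsV)
    have h1 : ∀ᵐ t : ℝ, t ≠ a' := by simp [MeasureTheory.ae_iff]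
    filter_upwards [h1] with t hta ht
    have ht' : t ∈ Set.Ioc a' t₀ := ⟨lt_of_le_of_ne ht.1 hta.symm, ht.2⟩
    have h2 := (hu.2 _ (hδM t ht')).1
    exact ⟨u (δ t), hcv t ht', h2.1.le, h2.2⟩
  obtain ⟨r, hr, hr0⟩ := exists_hasDerivAt_eq_zero (f := fun t => (e (δ t)) 1 - k * (e (δ t)) 0)
    (f' := fun t => (coordDiff e (δ t) (u (δ t))) 1 - k * (coordDiff e (δ t) (u (δ t))) 0) hat
    (by
      have h1 : ContinuousOn (fun t => e (δ t)) (Set.Icc a' t₀) :=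
        e.continuousOn.comp hlip.1 fun t ht => (hmaps ht).2
      have h2 : ∀ μ, ContinuousOn (fun t => (e (δ t)) μ) (Set.Icc a' t₀) := fun μ =>
        (EuclideanSpace.proj (𝕜 := ℝ) μ).continuous.comp_continuousOn h1
      exact (h2 1).sub (continuousOn_const.mul (h2 0)))
    (by
      simp only [hδa, hδq, he0, hq, e.right_inv hst]
      simp [w]; ring)
    (fun t ht => by
      have h1 := ((hcv t ⟨ht.1, ht.2.le⟩).hasDerivWithinAt he
        (hmaps ⟨ht.1.le, ht.2.le⟩).2).hasDerivAt (Icc_mem_nhds ht.1 ht.2)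
      have h2 : ∀ μ, HasDerivAt (fun t => (e (δ t)) μ) ((coordDiff e (δ t) (u (δ t))) μ) t :=
        fun μ => (EuclideanSpace.proj (𝕜 := ℝ) μ).hasFDerivAt.comp_hasDerivAt t h1
      exact (h2 1).sub ((h2 0).const_mul k))
  exact hWM ⟨(hmaps ⟨hr.1.le, hr.2.le⟩).1, hδM r ⟨hr.1, hr.2.le⟩⟩ hr0

end Limit

end Cosmology

end

theorem theorem2p4 {X : Type*} [TopologicalSpace X] [T2Space X]
    [ChartedSpace Cosmology.R4 X] [IsManifold (𝓡 4) ∞ X]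
    (S : Cosmology.Spacetime X)
    (M : Set X) (hM : IsOpen M) (hg : Cosmology.IsC2On S.g M)
    (u : Cosmology.VField X) (hu : Cosmology.IsObserverField S M u)
    (O : X) (hO : Cosmology.IsOriginPoint M u O)
    (ρ₀ p₀ : ℝ) (hT : Cosmology.LimitsToPerfectFluid S.g M u O ρ₀ p₀)
    (γ : ℝ → X) (J : Set ℝ) (a : ℝ) (hγ : Cosmology.IsMaxIntegralIn M u γ J) (ha : IsGLB J a)
    (hconv : Cosmology.LocTimelikeConvex S.g M γ a O)
    (Ric₀ : LinearMap.BilinForm ℝ (TangentSpace (𝓡 4) O))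
    (hRic : Cosmology.TensorExtends M O (Cosmology.Ric S.g) Ric₀)
    (hcausal : Cosmology.StronglyCausalAt S.g S.timeField O) :
    ρ₀ = -p₀ ∧ Ric₀ = (8 * Real.pi * ρ₀) • S.g O := by
  obtain ⟨ε, hε, hε2, e, he, hOe, he0, hcomp, hvel, hfut⟩ := hconv
  have hη : ∀ μ ν, Cosmology.comp S.g e μ ν O = Cosmology.eta μ ν := fun μ ν => (hcomp μ ν).1
  have hG : Filter.Tendsto (Cosmology.compMatrix S.g e) (𝓝[M] O)
      (𝓝 (Matrix.of Cosmology.eta)) := by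
    refine Cosmology.tendsto_matrix_iff.2 fun μ ν => ?_
    have h := ((S.continuous_metric e he μ ν).continuousAt (e.open_source.mem_nhds hOe)).tendsto
    rw [hη] at h
    exact h.mono_left nhdsWithin_le_nhds
  have hR := hRic.tendsto hO.1 he hOe
  set R₀ : Matrix (Fin 4) (Fin 4) ℝ := Matrix.of fun μ ν =>
    Ric₀ (Cosmology.coordVec e μ O) (Cosmology.coordVec e ν O) with hR₀
  have hN := hT.2.2.tendsto hO.1 he hOe
  set τ := ((Matrix.of Cosmology.eta)⁻¹ * R₀.transpose).trace with hτ
  have htr := Cosmology.tendsto_trace ((Cosmology.tendsto_inv_matrix hG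
    Cosmology.det_eta_ne_zero).mul (Cosmology.tendsto_transpose hR))
  have hE := ((hR.sub ((htr.const_mul (1 / 2)).smul hG)).const_smul (1 / (8 * Real.pi)))
  have hL := (hE.sub hN).sub (hG.const_smul p₀)
  have hD : Filter.Tendsto
      (fun p => (ρ₀ + p₀) • Cosmology.compMatrix (Cosmology.dualSquare S.g u) e p) (𝓝[M] O)
      (𝓝 ((1 / (8 * Real.pi)) • (R₀ - ((1 / 2) * τ) • Matrix.of Cosmology.eta)
        - p₀ • Matrix.of Cosmology.eta)) := by
    have h0 : (Matrix.of fun μ ν => (0 : LinearMap.BilinForm ℝ (TangentSpace (𝓡 4) O))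
        (Cosmology.coordVec e μ O) (Cosmology.coordVec e ν O)) = 0 := by ext; simp
    rw [h0, sub_zero] at hL
    refine hL.congr' ?_
    filter_upwards [mem_nhdsWithin_of_mem_nhds (e.open_source.mem_nhds hOe)] with p hp
    rw [← he.compMatrix_energyMomentum hp]
    ext μ ν
    simp [Cosmology.compMatrix, Cosmology.comp, Cosmology.perfectFluid, Cosmology.dualSquare]
  have hsum : ρ₀ + p₀ = 0 := by
    by_contra hne
    refine Cosmology.not_tendsto_dualSquare S hM hu hO hγ ha hε hε2 he hOe he0 hη hvel hfut
      hcausal _ ((hD.const_smul (ρ₀ + p₀)⁻¹).congr fun p => ?_)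
    rw [smul_smul, inv_mul_cancel₀ hne, one_smul]
  have hρ : ρ₀ = -p₀ := by linarith
  have hbot : (𝓝[M] O).NeBot := by
    obtain ⟨b, hb⟩ := hγ.1.2.2.1
    obtain ⟨hab, hsub⟩ := hγ.1.Ioc_subset ha hb
    obtain ⟨a', ha', hlim, -⟩ := hO.2 γ J hγ
    obtain rfl := ha'.unique ha
    refine (tendsto_nhdsWithin_iff.2 ⟨hlim, ?_⟩ : Filter.Tendsto γ _ _).neBot
    filter_upwards [Ioc_mem_nhdsGT hab] with t ht using (hγ.1.2.2.2 t (hsub ht)).1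
  have hzero : (1 / (8 * Real.pi)) • (R₀ - ((1 / 2) * τ) • Matrix.of Cosmology.eta)
        - p₀ • Matrix.of Cosmology.eta = 0 := by
    simp only [hsum, zero_smul] at hD
    exact tendsto_nhds_unique hD tendsto_const_nhds
  have hentry : ∀ μ ν, R₀ μ ν = (τ / 2 + 8 * Real.pi * p₀) * Cosmology.eta μ ν := by
    intro μ ν
    have h := congrFun (congrFun hzero μ) ν
    simp only [Matrix.sub_apply, Matrix.smul_apply, Matrix.of_apply, Matrix.zero_apply,
      smul_eq_mul] at h
    have hpi := Real.pi_pos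
    field_simp at h
    linarith
  have hτ' : τ = 4 * (τ / 2 + 8 * Real.pi * p₀) := by
    conv_lhs => rw [hτ, Cosmology.inv_eta]
    simp only [Matrix.trace, Matrix.diag, Matrix.mul_apply, Matrix.transpose_apply, hentry,
      Fin.sum_univ_four, Matrix.of_apply]
    simp [Cosmology.eta]
    ring
  refine ⟨hρ, ?_⟩
  have hbasis : ∀ μ ν, Ric₀ (Cosmology.coordVec e μ O) (Cosmology.coordVec e ν O) =
      8 * Real.pi * ρ₀ * S.g O (Cosmology.coordVec e μ O) (Cosmology.coordVec e ν O) := by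
    intro μ ν
    have h1 : Ric₀ (Cosmology.coordVec e μ O) (Cosmology.coordVec e ν O) = R₀ μ ν := rfl
    have h2 : S.g O (Cosmology.coordVec e μ O) (Cosmology.coordVec e ν O) =
      Cosmology.eta μ ν := hη μ ν
    rw [h1, h2, hentry, hρ]
    congr 1
    linarith
  refine LinearMap.ext fun v => LinearMap.ext fun w => ?_
  rw [he.sum_coordVec hOe v, he.sum_coordVec hOe w]
  simp only [map_sum, map_smul, LinearMap.sum_apply, LinearMap.smul_apply, smul_eq_mul,
    hbasis, Finset.mul_sum]
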